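/- A data structure problem $f:X\times Y\to Z$ has $(s,w,t)$-certificates if there is a map $T:Y\to(\{0,1\}^w)^s$, $y\mapsto T_y$ (a table of $s$ cells of $w$ bits each), such that for every query $x\in X$ and every database $y\in Y$ there is a set $P\subseteq\{1,\dots,s\}$ of cells with $|P|=t$ such that every database $y'\in Y$ with $T_{y'}(i)=T_y(i)$ for all $i\in P$ satisfies $f(x,y')=f(x,y)$. In the $d$-dimensional partial match problem $\mathrm{PM}_n^d$, a database $y$ consists of $n$ strings from $\{0,1\}^d$, a query is a pattern $x\in\{0,1,*\}^d$, and the answer is whether some string $z$ in $y$ satisfies $x_i=z_i$ for all $i$ with $x_i\ne *$. Logarithms are to base $2$. Theorem. For every natural number $C$ and every real $\varepsilon>0$ there is a constant $c>0$, depending only on $C$ and $\varepsilon$, such that the following holds for all natural numbers $n\ge 2$, $d,s,w,t$ with $d\ge 2\log n$, $w\le d^{C}$, $n\ge w^2d^8$ and $s\ge n\,d^{\varepsilon-1}$ (for example, $s\ge n$ when $\varepsilon=1$). If $\mathrm{PM}_n^d$ has $(s,w,t)$-certificates, then $$t\ \ge\ c\cdot\frac{d}{\log\frac{sd}{n}}.$$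 -/

import Mathlib

/-- `f : X → Y → Z` has `(s,w,t)`-certificates: databases are encoded by tables of `s` cells of
`w` bits, and for every query `x` and database `y` there are `t` cells whose contents in the table
of `y` determine the answer to `x`. -/
def HasCertificates {X Y Z : Type*} (f : X → Y → Z) (s w t : ℕ) : Prop :=
  ∃ T : Y → Fin s → (Fin w → Bool), ∀ (x : X) (y : Y), ∃ P : Finset (Fin s), P.card = t ∧
    ∀ y' : Y, (∀ i ∈ P, T y' i = T y i) → f x y' = f x y

/-- A pattern `x ∈ {0,1,*}^d` (with `none` for `*`) matches a string `z ∈ {0,1}^d` if they agree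
at every position where `x` is not `*`. -/
def Matches {d : ℕ} (x : Fin d → Option Bool) (z : Fin d → Bool) : Prop :=
  ∀ i : Fin d, x i ≠ none → x i = some (z i)

open Classical in
/-- The `d`-dimensional partial match problem: a database is a family of `n` strings, and the
answer to a pattern is whether some string of the database matches it. -/
noncomputable def partialMatch (n d : ℕ) (x : Fin d → Option Bool) (y : Fin n → Fin d → Bool) :
    Bool :=
  decide (∃ j : Fin n, Matches x (y j))

/-!
A lower bound for certificates of partial match, by a direct-sum form of the richness method.

The database is made of `k = ⌊n / N⌋` blocks of `N = w² d⁸` strings, some of them repeated when `N`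
does not divide `n`. The first `d / 2` bits of a string name its block; the remaining `m` bits are the indicator vector of the set of entries
of a tuple `z` of `ℓ ≈ log (2 N)` elements of an `m`-element set `V`. A query to a block is a set
`T ⊆ V`, written as `*` on `T` and `0` off `T`: it matches exactly the strings whose tuples have
all their entries in `T`. If `T` contains at most half of `V`, a random block of `N` tuples gives a
negative answer with probability at least `1 / 2`.

Consider lists of `k` queries, one to each block, all answered negatively. The union of their
certificates has only `k t` cells out of `s`, so choosing it costs `t log (e s / (k t))` nats per
block, which is `O(t log (s d / n))` because `w`, and hence `N`, is polynomial in `d`. The richness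
lemma for certificates (`exists_large_rectangle`) gives a large rectangle of negative
answers, whose projections to some block are both large (`exists_large_projections`): the queries
have density at least `e⁻ᵃ` and the databases density at least `e⁻ᵇ`, where
`a = O(1 + t log (s d / n))` and `b = a + O(w t)`.

If `a` is at most a small multiple of `d`, the queries of that block cover at least a fraction
`(3/4)^ℓ` of all tuples (`le_card_covered_tuples`), which is at least of order `1 / √N`. The
databases of the rectangle avoid all covered tuples, so their density is at most
`exp (-(3/4)^ℓ N)`, and `√N = w d⁴` is far larger than `b`. This contradiction
(`HasCertificates.block_bound`) forces `t log (s d / n)` to be of order `d`, at least when `d`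
exceeds a constant; for smaller `d` the bound only asks for `t ≥ 1`.
-/

/-! ### Tuples covered by a large family of sets -/

open Finset in
/-- `2 ^ #V` times the exponential moment of `#(D ∩ T)` for a uniformly random set `T`. -/
theorem sum_exp_neg_card_inter {V : Type*} [Fintype V] [DecidableEq V] (D : Finset V) :
    ∑ T : Finset V, Real.exp (-(#(D ∩ T) : ℝ)) =
      2 ^ Fintype.card V * ((1 + Real.exp (-1)) / 2) ^ #D := by
  have h1 : ∀ T : Finset V, Real.exp (-(#(D ∩ T) : ℝ)) =
      ∏ v ∈ T, if v ∈ D then Real.exp (-1) else 1 := by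
    intro T
    rw [Finset.prod_ite, Finset.prod_const, Finset.prod_const_one, mul_one, ← Real.exp_nat_mul,
      Finset.filter_mem_eq_inter, Finset.inter_comm]
    simp
  simp_rw [h1]
  rw [← Finset.powerset_univ, ← Finset.prod_one_add]
  have h2 : ∀ v : V, (1 + if v ∈ D then Real.exp (-1) else 1) =
      2 * if v ∈ D then (1 + Real.exp (-1)) / 2 else 1 := by
    intro v; split_ifs <;> ring
  simp_rw [h2]
  rw [Finset.prod_mul_distrib, Finset.prod_const, Finset.prod_ite]
  simp [div_pow]

open Finset in
/-- A family of sets whose members rarely contain any of the elements of `D` is exponentially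
small in `#D`. -/
theorem card_le_of_rare {V : Type*} [Fintype V] [DecidableEq V] (𝒜 : Finset (Finset V))
    (D : Finset V) (h : ∀ v ∈ D, 8 * #{T ∈ 𝒜 | v ∈ T} ≤ #𝒜) :
    (#𝒜 : ℝ) ≤ 2 ^ Fintype.card V * Real.exp (-(#D : ℝ) / 6) := by
  have h1 : ∑ T ∈ 𝒜, #(D ∩ T) ≤ #D * (#𝒜 / 8) :=
    Finset.sum_card_inter_le fun v hv => by have := h v hv; omega
  have h2 : ∑ T ∈ 𝒜, (#(D ∩ T) : ℝ) ≤ #D * (#𝒜 / 8 : ℝ) := by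
    have h3 : ((#𝒜 / 8 : ℕ) : ℝ) ≤ (#𝒜 : ℝ) / 8 := by
      simpa using (Nat.cast_div_le (α := ℝ) (m := #𝒜) (n := 8))
    calc ∑ T ∈ 𝒜, (#(D ∩ T) : ℝ) ≤ #D * ((#𝒜 / 8 : ℕ) : ℝ) := by exact_mod_cast h1
      _ ≤ _ := by gcongr
  set q : ℝ := #D / 8 with hq
  -- The tangent line of the exponential at `-q` turns the bound on the mean into one on the moment.
  have h4 : (#𝒜 : ℝ) * Real.exp (-q) ≤ ∑ T ∈ 𝒜, Real.exp (-(#(D ∩ T) : ℝ)) := by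
    calc (#𝒜 : ℝ) * Real.exp (-q)
        ≤ Real.exp (-q) * ∑ T ∈ 𝒜, (1 + (q - (#(D ∩ T) : ℝ))) := by
          rw [mul_comm]
          gcongr
          rw [Finset.sum_add_distrib, Finset.sum_sub_distrib]
          simp only [Finset.sum_const, nsmul_eq_mul, mul_one]
          rw [hq]
          linarith
      _ ≤ ∑ T ∈ 𝒜, Real.exp (-(#(D ∩ T) : ℝ)) := by
          rw [Finset.mul_sum]
          refine Finset.sum_le_sum fun T _ => ?_
          calc Real.exp (-q) * (1 + (q - (#(D ∩ T) : ℝ)))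
              ≤ Real.exp (-q) * Real.exp (q - (#(D ∩ T) : ℝ)) := by
                gcongr
                linarith [Real.add_one_le_exp (q - (#(D ∩ T) : ℝ))]
            _ = _ := by rw [← Real.exp_add]; congr 1; ring
  have h5 : ∑ T ∈ 𝒜, Real.exp (-(#(D ∩ T) : ℝ)) ≤ ∑ T : Finset V, Real.exp (-(#(D ∩ T) : ℝ)) :=
    Finset.sum_le_sum_of_subset_of_nonneg (Finset.subset_univ _) fun _ _ _ => (Real.exp_pos _).le
  rw [sum_exp_neg_card_inter] at h5
  have h6 : (1 + Real.exp (-1)) / 2 ≤ Real.exp (-(7 / 24)) := by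
    have := Real.exp_neg_one_lt_d9
    have := Real.add_one_le_exp (-(7 / 24) : ℝ)
    norm_num at *
    linarith
  have h7 : ((1 + Real.exp (-1)) / 2) ^ #D ≤ Real.exp (-(#D : ℝ) / 6) * Real.exp (-q) := by
    calc ((1 + Real.exp (-1)) / 2) ^ #D ≤ Real.exp (-(7 / 24)) ^ #D := by gcongr
      _ = _ := by
        rw [← Real.exp_nat_mul, ← Real.exp_add]; congr 1; rw [hq]; ring
  have h8 : (#𝒜 : ℝ) * Real.exp (-q) ≤
      2 ^ Fintype.card V * Real.exp (-(#D : ℝ) / 6) * Real.exp (-q) := by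
    rw [mul_assoc]
    exact (h4.trans h5).trans (by gcongr)
  exact le_of_mul_le_mul_right h8 (Real.exp_pos _)

open Finset in
/-- A family of at least `e⁻ᵃ 2 ^ #V` sets covers a fraction of at least `(3/4) ^ ℓ` of all
`ℓ`-tuples, a tuple being covered when one member of the family contains all its entries. The
entries are chosen one at a time: all but a quarter of the elements lie in an eighth of the
current family, and passing to the members that contain the chosen element keeps it large. -/
theorem le_card_covered_tuples {V : Type*} [Fintype V] [DecidableEq V] (ℓ : ℕ) :
    ∀ (𝒜 : Finset (Finset V)) (a : ℝ), 2 ^ Fintype.card V ≤ (#𝒜 : ℝ) * Real.exp a →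
      24 * (a + 3 * ℓ) ≤ Fintype.card V →
      (3 / 4 * (Fintype.card V : ℝ)) ^ ℓ ≤ #{z : Fin ℓ → V | ∃ T ∈ 𝒜, ∀ j, z j ∈ T} := by
  induction ℓ with
  | zero =>
    intro 𝒜 a h _
    have : 𝒜.Nonempty := by
      rw [Finset.nonempty_iff_ne_empty]
      rintro rfl
      simp at h
      linarith [pow_pos (two_pos : (0 : ℝ) < 2) (Fintype.card V)]
    obtain ⟨T, hT⟩ := this
    have : (#{z : Fin 0 → V | ∃ T ∈ 𝒜, ∀ j, z j ∈ T}) = 1 := by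
      rw [Finset.filter_true_of_mem fun z _ => ⟨T, hT, fun j => j.elim0⟩]
      simp
    rw [pow_zero]
    exact_mod_cast this.ge
  | succ ℓ ih =>
    intro 𝒜 a h hm
    push_cast at hm
    set D : Finset V := {v | 8 * #{T ∈ 𝒜 | v ∈ T} ≤ #𝒜} with hD
    have hDcard : (#D : ℝ) ≤ 6 * a := by
      have h1 := card_le_of_rare 𝒜 D fun v hv => by simpa [hD] using hv
      have h2 : (2 : ℝ) ^ Fintype.card V * 1 ≤
          2 ^ Fintype.card V * Real.exp (-(#D : ℝ) / 6 + a) := by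
        rw [mul_one, Real.exp_add, ← mul_assoc]
        exact h.trans (by gcongr)
      have h3 := le_of_mul_le_mul_left h2 (by positivity)
      rw [Real.one_le_exp_iff] at h3
      linarith
    have hDc : 3 / 4 * (Fintype.card V : ℝ) ≤ #Dᶜ := by
      have h1 : (#Dᶜ : ℝ) + #D = Fintype.card V := by
        exact_mod_cast Finset.card_compl_add_card D
      have : (0 : ℝ) ≤ ℓ := by positivity
      linarith
    have hstep : ∀ v ∈ Dᶜ, (3 / 4 * (Fintype.card V : ℝ)) ^ ℓ ≤
        #{z : Fin ℓ → V | ∃ T ∈ ({T ∈ 𝒜 | v ∈ T} : Finset (Finset V)), ∀ j, z j ∈ T} := by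
      intro v hv
      refine ih _ (a + 3) ?_ (by linarith)
      have h1 : (#𝒜 : ℝ) ≤ 8 * #{T ∈ 𝒜 | v ∈ T} := by
        have : ¬ 8 * #{T ∈ 𝒜 | v ∈ T} ≤ #𝒜 := by simpa [hD] using hv
        exact_mod_cast (not_le.mp this).le
      have h2 : (8 : ℝ) ≤ Real.exp 3 := by
        have h3 := Real.add_one_le_exp (1 : ℝ)
        have h4 : Real.exp 3 = Real.exp 1 ^ 3 := by rw [← Real.exp_nat_mul]; norm_num
        rw [h4]
        calc (8 : ℝ) = (1 + 1) ^ 3 := by norm_num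
          _ ≤ _ := by gcongr
      calc (2 : ℝ) ^ Fintype.card V ≤ (#𝒜 : ℝ) * Real.exp a := h
        _ ≤ (Real.exp 3 * #{T ∈ 𝒜 | v ∈ T}) * Real.exp a := by
          gcongr
          exact h1.trans (by gcongr)
        _ = _ := by rw [Real.exp_add]; ring
    have hinj : #(Dᶜ.sigma fun v => ({z : Fin ℓ → V | ∃ T ∈
          ({T ∈ 𝒜 | v ∈ T} : Finset (Finset V)), ∀ j, z j ∈ T} : Finset (Fin ℓ → V))) ≤
        #{z : Fin (ℓ + 1) → V | ∃ T ∈ 𝒜, ∀ j, z j ∈ T} := by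
      refine Finset.card_le_card_of_injOn
        (fun p => (Fin.cons p.1 p.2 : Fin (ℓ + 1) → V)) ?_ ?_
      · rintro ⟨v, z⟩ hp
        simp only [Finset.coe_sigma, Set.mem_sigma_iff, Finset.mem_coe, Finset.mem_filter,
          Finset.mem_univ, true_and] at hp ⊢
        obtain ⟨_, T, ⟨hT, hv⟩, hz⟩ := hp
        exact ⟨T, hT, Fin.cases (by simpa using hv) (by simpa using hz)⟩
      · rintro ⟨v, z⟩ _ ⟨v', z'⟩ _ heq
        obtain ⟨rfl, rfl⟩ := Fin.cons_inj.mp heq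
        rfl
    rw [Finset.card_sigma] at hinj
    calc (3 / 4 * (Fintype.card V : ℝ)) ^ (ℓ + 1)
        = 3 / 4 * (Fintype.card V : ℝ) * (3 / 4 * (Fintype.card V : ℝ)) ^ ℓ := pow_succ' _ _
      _ ≤ #Dᶜ * (3 / 4 * (Fintype.card V : ℝ)) ^ ℓ := by gcongr
      _ = ∑ v ∈ Dᶜ, (3 / 4 * (Fintype.card V : ℝ)) ^ ℓ := by simp
      _ ≤ _ := Finset.sum_le_sum hstep
      _ ≤ _ := by exact_mod_cast hinj

/-! ### Density of queries and databases in one block -/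

open Finset in
/-- If a set covers at most a fraction `θ` of the points of `Z`, at least a fraction `1 - N θ` of
the `N`-tuples avoid it. -/
theorem one_sub_mul_le_card_avoiding {Z : Type*} [Fintype Z] [DecidableEq Z] (H : Finset Z)
    (N : ℕ) (θ : ℝ) (hθ : (#H : ℝ) ≤ θ * Fintype.card Z) (hθ1 : θ ≤ 1) :
    (1 - N * θ) * (Fintype.card Z : ℝ) ^ N ≤ #{y : Fin N → Z | ∀ j, y j ∉ H} := by
  have h1 : ({y : Fin N → Z | ∀ j, y j ∉ H} : Finset (Fin N → Z)) =
      Fintype.piFinset fun _ => Hᶜ := by ext; simp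
  have h2 : (#Hᶜ : ℝ) + #H = Fintype.card Z := by exact_mod_cast Finset.card_compl_add_card H
  rw [h1, Fintype.card_piFinset, Finset.prod_const, Finset.card_univ, Fintype.card_fin]
  push_cast
  have h3 : 1 - N * θ ≤ (1 - θ) ^ N := by
    have := one_add_mul_le_pow (a := -θ) (by linarith) N
    simpa [sub_eq_add_neg] using this
  calc (1 - N * θ) * (Fintype.card Z : ℝ) ^ N ≤ (1 - θ) ^ N * (Fintype.card Z : ℝ) ^ N := by gcongr
    _ = ((1 - θ) * Fintype.card Z) ^ N := (mul_pow _ _ _).symm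
    _ ≤ (#Hᶜ : ℝ) ^ N := by
      have : 0 ≤ 1 - θ := by linarith
      gcongr
      linarith

open Finset in
/-- If a set covers a fraction `θ` of the points of `Z`, few `N`-tuples avoid it. -/
theorem card_le_of_avoiding {Z : Type*} [Fintype Z] [DecidableEq Z] (H : Finset Z)
    (N : ℕ) (θ : ℝ) (hθ : θ * Fintype.card Z ≤ (#H : ℝ)) (B : Finset (Fin N → Z))
    (hB : ∀ y ∈ B, ∀ j, y j ∉ H) :
    (#B : ℝ) ≤ Real.exp (-(θ * N)) * (Fintype.card Z : ℝ) ^ N := by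
  have h1 : B ⊆ Fintype.piFinset fun _ => Hᶜ := fun y hy => by simpa using hB y hy
  have h2 : (#Hᶜ : ℝ) + #H = Fintype.card Z := by exact_mod_cast Finset.card_compl_add_card H
  have h3 := Finset.card_le_card h1
  rw [Fintype.card_piFinset, Finset.prod_const, Finset.card_univ, Fintype.card_fin] at h3
  have h4 : (#Hᶜ : ℝ) ≤ Real.exp (-θ) * Fintype.card Z := by
    calc (#Hᶜ : ℝ) ≤ (-θ + 1) * Fintype.card Z := by linarith
      _ ≤ _ := by gcongr; exact Real.add_one_le_exp _
  calc (#B : ℝ) ≤ (#Hᶜ : ℝ) ^ N := by exact_mod_cast h3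
    _ ≤ (Real.exp (-θ) * Fintype.card Z) ^ N := by gcongr
    _ = _ := by rw [mul_pow, ← Real.exp_nat_mul]; congr 2; ring

open Finset in
/-- At least half of all subsets contain at most half of the elements. -/
theorem two_pow_card_le_two_mul_card_small {V : Type*} [Fintype V] [DecidableEq V] :
    2 ^ Fintype.card V ≤ 2 * #{T : Finset V | 2 * #T ≤ Fintype.card V} := by
  have h1 : #{T : Finset V | ¬ 2 * #T ≤ Fintype.card V} ≤
      #{T : Finset V | 2 * #T ≤ Fintype.card V} := by
    refine Finset.card_le_card_of_injOn compl ?_ compl_injective.injOn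
    intro T hT
    have := Finset.card_compl_add_card T
    simp only [Finset.coe_filter, Finset.mem_univ, true_and, Set.mem_ofPred_eq] at hT ⊢
    omega
  have h2 := Finset.card_filter_add_card_filter_not (s := (univ : Finset (Finset V)))
    (fun T => 2 * #T ≤ Fintype.card V)
  rw [Finset.card_univ, Fintype.card_finset] at h2
  omega

/-! ### Richness for certificates -/

open Finset in
/-- The richness lemma for certificates: a relation that holds on a fraction `β` of every row and
all of whose instances have certificates of `K` cells contains a large rectangle. For a fixed set
of cells, the databases are partitioned by the contents of these cells, and every content gives a
rectangle; the rectangles of all sets of cells cover the relation. -/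
theorem exists_large_rectangle {X Y W : Type*} [Fintype X] [Fintype Y] [Fintype W]
    [DecidableEq W] [DecidableEq X] [DecidableEq Y] [Nonempty X] [Nonempty Y] [Nonempty W]
    {s K : ℕ} (hK : K ≤ s) (T : Y → Fin s → W) (R : X → Y → Prop) [DecidableRel R]
    (hR : ∀ x y, R x y → ∃ P : Finset (Fin s), #P = K ∧
      ∀ y', (∀ i ∈ P, T y' i = T y i) → R x y')
    {β : ℝ} (hβ : 0 < β) (hdense : ∀ x, β * Fintype.card Y ≤ #{y | R x y}) :
    ∃ (A : Finset X) (B : Finset Y), (∀ x ∈ A, ∀ y ∈ B, R x y) ∧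
      β * Fintype.card X ≤ 2 * s.choose K * #A ∧
      β * Fintype.card Y ≤ 2 * s.choose K * (Fintype.card W : ℝ) ^ K * #B := by
  classical
  let B : (P : Finset (Fin s)) → (P → W) → Finset Y := fun P a => {y | ∀ i : P, T y i = a i}
  let A : (P : Finset (Fin s)) → (P → W) → Finset X := fun P a => {x | ∀ y ∈ B P a, R x y}
  set cells : Finset (Finset (Fin s)) := powersetCard K univ with hcells
  have hcellsCard : #cells = s.choose K := by simp [hcells]
  have hC : (0 : ℝ) < s.choose K := by exact_mod_cast Nat.choose_pos hK
  have hX : (0 : ℝ) < Fintype.card X := by exact_mod_cast Fintype.card_pos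
  have hY : (0 : ℝ) < Fintype.card Y := by exact_mod_cast Fintype.card_pos
  have hW : (0 : ℝ) < (Fintype.card W : ℝ) ^ K := by
    have : (0 : ℝ) < Fintype.card W := by exact_mod_cast Fintype.card_pos
    positivity
  set α : ℝ := β * Fintype.card X / (2 * s.choose K) with hα
  set γ : ℝ := β * Fintype.card Y / (2 * s.choose K * (Fintype.card W : ℝ) ^ K) with hγ
  have hγ0 : 0 < γ := by positivity
  have hα0 : 0 < α := by positivity
  suffices h : ∃ P ∈ cells, ∃ a : P → W, α ≤ #(A P a) ∧ γ ≤ #(B P a) by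
    obtain ⟨P, _, a, h1, h2⟩ := h
    refine ⟨A P a, B P a, fun x hx y hy => (Finset.mem_filter.mp hx).2 y hy, ?_, ?_⟩
    · rw [hα, div_le_iff₀ (by positivity)] at h1
      linarith
    · rw [hγ, div_le_iff₀ (by positivity)] at h2
      linarith
  by_contra! hcon
  have hlt : ∀ P ∈ cells, ∀ a : P → W,
      (#(A P a) : ℝ) * #(B P a) < α * #(B P a) + Fintype.card X * γ := by
    intro P hP a
    have hAX : (#(A P a) : ℝ) ≤ Fintype.card X := by exact_mod_cast Finset.card_le_univ _
    have hB0 : (0 : ℝ) ≤ #(B P a) := by positivity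
    rcases lt_or_ge (#(A P a) : ℝ) α with h | h
    · have := mul_le_mul_of_nonneg_right h.le hB0
      have := mul_pos hX hγ0
      linarith
    · have h2 := hcon P hP a h
      have := mul_le_mul_of_nonneg_right hAX hB0
      have := mul_lt_mul_of_pos_left h2 hX
      have := mul_nonneg hα0.le hB0
      linarith
  have hpart : ∀ P : Finset (Fin s), ∑ a : P → W, (#(B P a) : ℝ) = Fintype.card Y := by
    intro P
    have := Finset.card_eq_sum_card_fiberwise (s := (univ : Finset Y))
      (t := (univ : Finset (P → W))) (f := fun y (i : P) => T y i)
      (fun _ _ => Finset.mem_coe.2 (mem_univ _))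
    rw [Finset.card_univ] at this
    rw [this]
    push_cast
    refine Finset.sum_congr rfl fun a _ => ?_
    congr 2
    ext y
    simp [B, funext_iff]
  have hsum : ∑ P ∈ cells, ∑ a : P → W, (#(A P a) : ℝ) * #(B P a) <
      β * (Fintype.card X * Fintype.card Y) := by
    have hne : cells.Nonempty := by
      rw [← Finset.card_pos, hcellsCard]
      exact Nat.choose_pos hK
    calc ∑ P ∈ cells, ∑ a : P → W, (#(A P a) : ℝ) * #(B P a)
        < ∑ P ∈ cells, ∑ a : P → W, (α * #(B P a) + Fintype.card X * γ) :=
          Finset.sum_lt_sum_of_nonempty hne fun P hP =>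
            Finset.sum_lt_sum_of_nonempty Finset.univ_nonempty fun a _ => hlt P hP a
      _ = ∑ P ∈ cells, (α * Fintype.card Y + (Fintype.card W : ℝ) ^ K * (Fintype.card X * γ)) := by
          refine Finset.sum_congr rfl fun P hP => ?_
          rw [Finset.sum_add_distrib, ← Finset.mul_sum, hpart, Finset.sum_const, Finset.card_univ,
            Fintype.card_fun, Fintype.card_coe, (Finset.mem_powersetCard.mp hP).2, nsmul_eq_mul]
          push_cast
          rfl
      _ = β * (Fintype.card X * Fintype.card Y) := by
          rw [Finset.sum_const, hcellsCard, nsmul_eq_mul, hα, hγ]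
          field_simp
          ring
  have hcover : ({p : X × Y | R p.1 p.2} : Finset (X × Y)) ⊆
      cells.biUnion fun P => univ.biUnion fun a => A P a ×ˢ B P a := by
    rintro ⟨x, y⟩ hxy
    obtain ⟨P, hP, hc⟩ := hR x y (by simpa using hxy)
    simp only [mem_biUnion, mem_univ, true_and, mem_product]
    refine ⟨P, by simp [hcells, hP], fun i => T y i, ?_, by simp [B]⟩
    simp only [A, B, mem_filter, mem_univ, true_and]
    exact fun y' hy' => hc y' fun i hi => hy' ⟨i, hi⟩
  have hcount : #{p : X × Y | R p.1 p.2} ≤ ∑ P ∈ cells, ∑ a : P → W, #(A P a) * #(B P a) := by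
    refine (Finset.card_le_card hcover).trans (Finset.card_biUnion_le.trans ?_)
    refine Finset.sum_le_sum fun P _ => Finset.card_biUnion_le.trans ?_
    simp
  have hrows : β * (Fintype.card X * Fintype.card Y) ≤ #{p : X × Y | R p.1 p.2} := by
    have h1 : #{p : X × Y | R p.1 p.2} = ∑ x : X, #{y | R x y} := by
      simp only [Finset.card_filter]
      rw [Fintype.sum_prod_type]
    rw [h1]
    push_cast
    calc β * (Fintype.card X * Fintype.card Y) = ∑ x : X, β * Fintype.card Y := by
          rw [Finset.sum_const, Finset.card_univ, nsmul_eq_mul]; ring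
      _ ≤ _ := Finset.sum_le_sum fun x _ => hdense x
  have : (#{p : X × Y | R p.1 p.2} : ℝ) ≤ ∑ P ∈ cells, ∑ a : P → W, (#(A P a) : ℝ) * #(B P a) := by
    exact_mod_cast hcount
  linarith

open Finset in
/-- The projections of a large family of `k`-tuples are large on average: the family is contained
in the product of its projections. -/
theorem sum_log_card_div_card_image_le {X : Type*} [Fintype X] [DecidableEq X] [Nonempty X] {k : ℕ}
    (A : Finset (Fin k → X)) (a : ℝ) (hA : (Fintype.card X : ℝ) ^ k ≤ #A * Real.exp (k * a)) :
    ∑ i, (Real.log (Fintype.card X) - Real.log #(A.image fun x => x i)) ≤ k * a := by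
  have hX : (0 : ℝ) < Fintype.card X := by exact_mod_cast Fintype.card_pos
  have hApos : (0 : ℝ) < #A := by
    have := (pow_pos hX k).trans_le hA
    exact pos_of_mul_pos_left this (Real.exp_pos _).le
  have hne : A.Nonempty := by
    rw [← Finset.card_pos]; exact_mod_cast hApos
  have h1 : #A ≤ ∏ i, #(A.image fun x => x i) := by
    rw [← Fintype.card_piFinset]
    refine Finset.card_le_card fun x hx => ?_
    rw [Fintype.mem_piFinset]
    exact fun i => Finset.mem_image_of_mem (fun x : Fin k → X => x i) hx
  have h2 : Real.log #A ≤ ∑ i, Real.log #(A.image fun x => x i) := by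
    rw [← Real.log_prod]
    · refine Real.log_le_log hApos ?_
      exact_mod_cast h1
    · intro i _
      have := Finset.card_pos.2 (hne.image fun x => x i)
      positivity
  have h3 := Real.log_le_log (by positivity) hA
  rw [Real.log_pow, Real.log_mul hApos.ne' (Real.exp_ne_zero _), Real.log_exp] at h3
  rw [Finset.sum_sub_distrib, Finset.sum_const, Finset.card_univ, Fintype.card_fin, nsmul_eq_mul]
  linarith

open Finset in
/-- If two families of `k`-tuples are both large, then at one coordinate both projections are
large. -/
theorem exists_large_projections {X Y : Type*} [Fintype X] [Fintype Y] [DecidableEq X]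
    [DecidableEq Y] [Nonempty X] [Nonempty Y] {k : ℕ} (hk : 0 < k)
    (A : Finset (Fin k → X)) (B : Finset (Fin k → Y)) {a b : ℝ} (ha : 0 < a) (hb : 0 < b)
    (hA : (Fintype.card X : ℝ) ^ k ≤ #A * Real.exp (k * a))
    (hB : (Fintype.card Y : ℝ) ^ k ≤ #B * Real.exp (k * b)) :
    ∃ i, (Fintype.card X : ℝ) ≤ #(A.image fun x => x i) * Real.exp (2 * a) ∧
      (Fintype.card Y : ℝ) ≤ #(B.image fun y => y i) * Real.exp (2 * b) := by
  have hX : (0 : ℝ) < Fintype.card X := by exact_mod_cast Fintype.card_pos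
  have hY : (0 : ℝ) < Fintype.card Y := by exact_mod_cast Fintype.card_pos
  have hAne : A.Nonempty := by
    rw [Finset.nonempty_iff_ne_empty]
    rintro rfl
    have := pow_pos hX k
    simp at hA
    linarith
  have hBne : B.Nonempty := by
    rw [Finset.nonempty_iff_ne_empty]
    rintro rfl
    have := pow_pos hY k
    simp at hB
    linarith
  set u : Fin k → ℝ := fun i =>
    Real.log (Fintype.card X) - Real.log #(A.image fun x => x i) with hu
  set v : Fin k → ℝ := fun i =>
    Real.log (Fintype.card Y) - Real.log #(B.image fun x => x i) with hv
  have hpA : ∀ i, (0 : ℝ) < #(A.image fun x => x i) := fun i => by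
    exact_mod_cast Finset.card_pos.2 (hAne.image fun x => x i)
  have hpB : ∀ i, (0 : ℝ) < #(B.image fun x => x i) := fun i => by
    exact_mod_cast Finset.card_pos.2 (hBne.image fun x => x i)
  have hu0 : ∀ i, 0 ≤ u i := fun i =>
    sub_nonneg.2 (Real.log_le_log (hpA i) (by exact_mod_cast Finset.card_le_univ _))
  have hv0 : ∀ i, 0 ≤ v i := fun i =>
    sub_nonneg.2 (Real.log_le_log (hpB i) (by exact_mod_cast Finset.card_le_univ _))
  have hus : ∑ i, u i ≤ k * a := sum_log_card_div_card_image_le A a hA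
  have hvs : ∑ i, v i ≤ k * b := sum_log_card_div_card_image_le B b hB
  have hsum : ∑ i, (u i / a + v i / b) ≤ ∑ _i : Fin k, (2 : ℝ) := by
    rw [Finset.sum_add_distrib, ← Finset.sum_div, ← Finset.sum_div, Finset.sum_const,
      Finset.card_univ, Fintype.card_fin, nsmul_eq_mul]
    have h1 : (∑ i, u i) / a ≤ k := by rwa [div_le_iff₀ ha]
    have h2 : (∑ i, v i) / b ≤ k := by rwa [div_le_iff₀ hb]
    linarith
  have : Nonempty (Fin k) := ⟨⟨0, hk⟩⟩
  obtain ⟨i, _, hi⟩ := Finset.exists_le_of_sum_le Finset.univ_nonempty hsum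
  have h1 : u i ≤ 2 * a := by
    rw [← div_le_iff₀ ha]
    linarith [div_nonneg (hv0 i) hb.le]
  have h2 : v i ≤ 2 * b := by
    rw [← div_le_iff₀ hb]
    linarith [div_nonneg (hu0 i) ha.le]
  refine ⟨i, ?_, ?_⟩
  · rw [← Real.log_le_log_iff hX (mul_pos (hpA i) (Real.exp_pos _)),
      Real.log_mul (hpA i).ne' (Real.exp_ne_zero _), Real.log_exp]
    linarith
  · rw [← Real.log_le_log_iff hY (mul_pos (hpB i) (Real.exp_pos _)),
      Real.log_mul (hpB i).ne' (Real.exp_ne_zero _), Real.log_exp]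
    linarith

/-- `s.choose K ≤ (e s / K) ^ K`. -/
theorem choose_le_exp {s K : ℕ} (hK : 0 < K) (hs : 0 < s) :
    (s.choose K : ℝ) ≤ Real.exp (K * (1 + Real.log (s / K))) := by
  have hK' : (0 : ℝ) < K := by exact_mod_cast hK
  have hs' : (0 : ℝ) < s := by exact_mod_cast hs
  have h1 := Nat.choose_le_pow_div (α := ℝ) K s
  have h2 := Real.pow_div_factorial_le_exp (x := (K : ℝ)) hK'.le K
  have h3 : Real.exp (K * (1 + Real.log (s / K))) = Real.exp K * ((s : ℝ) / K) ^ K := by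
    rw [mul_add, Real.exp_add, mul_one, Real.exp_nat_mul, Real.exp_log (by positivity)]
  rw [h3]
  calc (s.choose K : ℝ) ≤ (s : ℝ) ^ K / K.factorial := h1
    _ = (K : ℝ) ^ K / K.factorial * ((s : ℝ) / K) ^ K := by rw [div_pow]; field_simp
    _ ≤ _ := by gcongr

/-! ### Blocks inside partial match -/

/-- The pattern asking whether block `u` contains a tuple with all entries in `T`: the name of the
block, followed by a `*` at the elements of `T` and a `0` elsewhere. -/
def blockQuery {p m : ℕ} (u : Fin p → Bool) (T : Finset (Fin m)) : Fin (p + m) → Option Bool :=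
  Fin.append (fun i => some (u i)) fun v => if v ∈ T then none else some false

/-- The string of block `u` that represents the tuple `z`: the name of the block, followed by the
indicator vector of the set of entries of `z`. -/
def blockString {p m ℓ : ℕ} (u : Fin p → Bool) (z : Fin ℓ → Fin m) : Fin (p + m) → Bool :=
  Fin.append u fun v => decide (∃ j, z j = v)

theorem matches_blockQuery_blockString {p m ℓ : ℕ} (u u' : Fin p → Bool) (T : Finset (Fin m))
    (z : Fin ℓ → Fin m) :
    Matches (blockQuery u T) (blockString u' z) ↔ u = u' ∧ ∀ j, z j ∈ T := by
  unfold Matches blockQuery blockString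
  rw [Fin.forall_fin_add]
  simp only [Fin.append_left, Fin.append_right]
  refine and_congr (by simp [funext_iff]) ⟨fun h j => ?_, fun h v => ?_⟩
  · by_contra hj
    have := h (z j)
    simp [hj] at this
  · by_cases hv : v ∈ T
    · simp [hv]
    · simp only [hv, if_false]
      intro _
      have : ¬ ∃ j, z j = v := by
        rintro ⟨j, rfl⟩
        exact hv (h j)
      simp [this]

/-- The partial match problem is not constant in the database, so its certificates are nonempty
sets of nonempty cells. -/
theorem HasCertificates.pos_of_partialMatch {n d s w t : ℕ} (hn : 0 < n) (hd : 0 < d)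
    (h : HasCertificates (partialMatch n d) s w t) : 0 < w ∧ 0 < t := by
  obtain ⟨T, hT⟩ := h
  obtain ⟨P, hPt, hP⟩ := hT (fun _ => some false) (fun _ _ => false)
  have hne : partialMatch n d (fun _ => some false) (fun _ _ => true) ≠
      partialMatch n d (fun _ => some false) (fun _ _ => false) := by
    have : Nonempty (Fin n) := ⟨⟨0, hn⟩⟩
    have : Nonempty (Fin d) := ⟨⟨0, hd⟩⟩
    simp [partialMatch, Matches]
  constructor
  · rcases Nat.eq_zero_or_pos w with rfl | hw
    · exact absurd (hP _ fun i _ => Subsingleton.elim _ _) hne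
    · exact hw
  · rcases Nat.eq_zero_or_pos t with rfl | ht
    · rw [Finset.card_eq_zero] at hPt
      subst hPt
      exact absurd (hP _ (by simp)) hne
    · exact ht

open Finset in
/-- Certificates for partial match give certificates for the negative answers to a list of `k`
queries, one to each of `k` blocks of `N` tuples: the union of the certificates of the queries. -/
theorem HasCertificates.exists_block_certificates {n p m s w t k N : ℕ} (ℓ : ℕ) (hk : 0 < k)
    (hN : 0 < N) (hkN : k * N ≤ n) (hkp : k ≤ 2 ^ p) (hkt : k * t ≤ s)
    (h : HasCertificates (partialMatch n (p + m)) s w t) :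
    ∃ T : (Fin k → Fin N → Fin ℓ → Fin m) → Fin s → (Fin w → Bool),
      ∀ (x : Fin k → Finset (Fin m)) (y : Fin k → Fin N → Fin ℓ → Fin m),
        (∀ i j, ¬ ∀ r, y i j r ∈ x i) → ∃ P : Finset (Fin s), #P = k * t ∧
          ∀ y', (∀ i ∈ P, T y' i = T y i) → ∀ i j, ¬ ∀ r, y' i j r ∈ x i := by
  obtain ⟨T, hT⟩ := h
  obtain ⟨e⟩ : Nonempty (Fin k ↪ (Fin p → Bool)) :=
    Function.Embedding.nonempty_of_card_le (by simpa using hkp)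
  obtain ⟨π, hπ⟩ : ∃ π : Fin n → Fin k × Fin N, Function.Surjective π := by
    have : Nonempty (Fin k × Fin N) := ⟨⟨0, hk⟩, ⟨0, hN⟩⟩
    obtain ⟨f⟩ : Nonempty (Fin k × Fin N ↪ Fin n) :=
      Function.Embedding.nonempty_of_card_le (by simpa using hkN)
    exact ⟨Function.invFun f, Function.invFun_surjective f.injective⟩
  set db : (Fin k → Fin N → Fin ℓ → Fin m) → Fin n → Fin (p + m) → Bool :=
    fun y q => blockString (e (π q).1) (y (π q).1 (π q).2) with hdb
  have hmatch : ∀ (i : Fin k) (S : Finset (Fin m)) y,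
      partialMatch n (p + m) (blockQuery (e i) S) (db y) = false ↔
        ∀ j, ¬ ∀ r, y i j r ∈ S := by
    intro i S y
    simp only [partialMatch, hdb, matches_blockQuery_blockString, decide_eq_false_iff_not,
      not_exists, not_and, e.injective.eq_iff]
    constructor
    · intro hq j
      obtain ⟨q, hq'⟩ := hπ (i, j)
      have := hq q
      rw [hq'] at this
      exact this rfl
    · rintro hj q rfl
      exact hj _
  refine ⟨fun y => T (db y), fun x y hxy => ?_⟩
  choose P hPt hP using fun i => hT (blockQuery (e i) (x i)) (db y)
  have hcard : #(univ.biUnion P) ≤ k * t := by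
    refine Finset.card_biUnion_le.trans ?_
    simp [hPt]
  obtain ⟨Q, hPQ, hQ⟩ := Finset.exists_superset_card_eq hcard (by simpa using hkt)
  refine ⟨Q, hQ, fun y' hy' i => ?_⟩
  rw [← hmatch, hP i (db y') fun c hc => hy' c (hPQ (Finset.mem_biUnion.2 ⟨i, mem_univ i, hc⟩)),
    hmatch]
  exact hxy i

open Finset in
/-- The lower bound in terms of the parameters of the construction: if `t * L` is small compared
with the number `m` of positions, then the rectangle given by the richness lemma contains one block
whose queries cover a fraction `(3/4) ^ ℓ` of all tuples, whereas the databases avoid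
these tuples. -/
theorem HasCertificates.block_bound {n p m s w t k N ℓ : ℕ} {L : ℝ} (hk : 0 < k)
    (hN : 0 < N) (hm : 0 < m) (hkN : k * N ≤ n) (hkp : k ≤ 2 ^ p) (hkt : k * t ≤ s)
    (hℓ : 2 * N ≤ 2 ^ ℓ) (hL : 0 ≤ L) (hchoose : (s.choose (k * t) : ℝ) ≤ Real.exp (k * (t * L)))
    (hbig : 24 * (2 * (t * L + 2) + 1 + 3 * ℓ) ≤ (m : ℝ))
    (h : HasCertificates (partialMatch n (p + m)) s w t) :
    (3 / 4 : ℝ) ^ ℓ * N ≤ 2 * (t * L + 2 + w * t) := by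
  classical
  obtain ⟨T, hT⟩ := h.exists_block_certificates ℓ hk hN hkN hkp hkt
  have : Nonempty (Fin m) := ⟨⟨0, hm⟩⟩
  let X := {S : Finset (Fin m) // 2 * #S ≤ m}
  have : Nonempty X := ⟨⟨∅, by simp⟩⟩
  let Z := Fin ℓ → Fin m
  have hZ : (Fintype.card Z : ℝ) = (m : ℝ) ^ ℓ := by simp [Z]
  let Y := Fin N → Z
  have hY : (Fintype.card Y : ℝ) = (Fintype.card Z : ℝ) ^ N := by simp [Y]
  have hXcard : (2 : ℝ) ^ m ≤ 2 * Fintype.card X := by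
    have h1 := two_pow_card_le_two_mul_card_small (V := Fin m)
    rw [Fintype.card_fin, ← Fintype.card_subtype] at h1
    exact_mod_cast h1
  -- A tuple lies in a fixed small set with probability at most `2⁻ˡ ≤ 1 / (2 N)`.
  have hrow : ∀ S : X, (1 / 2 : ℝ) * Fintype.card Y ≤ #{y : Y | ∀ j, ¬ ∀ r, y j r ∈ S.1} := by
    intro S
    set H : Finset Z := {z | ∀ r, z r ∈ S.1} with hH
    have hHpi : H = Fintype.piFinset fun _ => S.1 := by 
      ext z
      rw [hH, Finset.mem_filter_univ]
      exact Fintype.mem_piFinset.symm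
    have hHcard : (#H : ℝ) ≤ (1 / 2) ^ ℓ * Fintype.card Z := by
      rw [hHpi, Fintype.card_piFinset, Finset.prod_const, Finset.card_univ, Fintype.card_fin, hZ,
        ← mul_pow]
      push_cast
      have : (2 : ℝ) * #S.1 ≤ m := by exact_mod_cast S.2
      gcongr
      linarith
    have h1 := one_sub_mul_le_card_avoiding H N _ hHcard (pow_le_one₀ (by norm_num) (by norm_num))
    have h2 : (N : ℝ) * (1 / 2) ^ ℓ ≤ 1 / 2 := by
      have : (2 : ℝ) * N ≤ 2 ^ ℓ := by exact_mod_cast hℓ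
      rw [one_div_pow, mul_one_div, div_le_div_iff₀ (by positivity) (by norm_num)]
      linarith
    have h3 : #{y : Fin N → Z | ∀ j, y j ∉ H} = #{y : Y | ∀ j, ¬ ∀ r, y j r ∈ S.1} := by
      congr 1
      ext y
      simp [hH]
    rw [← h3, hY]
    refine le_trans ?_ h1
    gcongr
    linarith
  let R : (Fin k → X) → (Fin k → Y) → Prop := fun x y => ∀ i j, ¬ ∀ r, y i j r ∈ (x i).1
  have hdense : ∀ x : Fin k → X,
      (1 / 2 : ℝ) ^ k * Fintype.card (Fin k → Y) ≤ #{y : Fin k → Y | R x y} := by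
    intro x
    have h1 : ({y : Fin k → Y | R x y} : Finset (Fin k → Y)) =
        Fintype.piFinset fun i => {y : Y | ∀ j, ¬ ∀ r, y j r ∈ (x i).1} := by
      ext y
      simp [R]
    rw [h1, Fintype.card_piFinset]
    push_cast
    calc (1 / 2 : ℝ) ^ k * Fintype.card (Fin k → Y)
        = ∏ _i : Fin k, (1 / 2 : ℝ) * Fintype.card Y := by
          rw [Fintype.card_fun, Fintype.card_fin, Finset.prod_const, Finset.card_univ,
            Fintype.card_fin, mul_pow]
          push_cast
          rfl
      _ ≤ _ := Finset.prod_le_prod (fun _ _ => by positivity) fun i _ => hrow (x i)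
  obtain ⟨A, B, hAB, hA, hB⟩ := exists_large_rectangle hkt T R
    (fun x y hxy => hT (fun i => (x i).1) y hxy) (by positivity) hdense
  -- The factors `2 ^ k` and `2` lost by the density and by the richness lemma cost `2` per block.
  have hexp : ∀ c M : ℝ, 0 ≤ c → 0 ≤ M → (1 / 2 : ℝ) ^ k * c ≤ 2 * s.choose (k * t) * M →
      c ≤ M * Real.exp (k * (t * L + 2)) := by
    intro c M hc0 hM hc
    have h2 : (2 : ℝ) ≤ Real.exp 1 := by linarith [Real.add_one_le_exp (1 : ℝ)]
    have h3 : (2 : ℝ) ^ k ≤ Real.exp k := by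
      rw [← Real.exp_one_pow]; gcongr
    have h4 : (2 : ℝ) ≤ Real.exp k :=
      h2.trans (Real.exp_le_exp.2 (by exact_mod_cast hk))
    have h5 : c = 2 ^ k * ((1 / 2 : ℝ) ^ k * c) := by
      rw [← mul_assoc, ← mul_pow]; norm_num
    rw [h5]
    calc (2 : ℝ) ^ k * ((1 / 2 : ℝ) ^ k * c)
        ≤ Real.exp k * (Real.exp k * Real.exp (k * (t * L)) * M) := by
          refine mul_le_mul h3 (hc.trans ?_) (by positivity) (Real.exp_pos _).le
          gcongr
      _ = M * Real.exp (k * (t * L + 2)) := by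
          have : (k : ℝ) * (t * L + 2) = k + (k + k * (t * L)) := by ring
          rw [this, Real.exp_add, Real.exp_add]; ring
  have hA' : (Fintype.card X : ℝ) ^ k ≤ #A * Real.exp (k * (t * L + 2)) := by
    refine hexp _ _ (by positivity) (by positivity) ?_
    rw [Fintype.card_fun, Fintype.card_fin] at hA
    exact_mod_cast hA
  have hB' : (Fintype.card Y : ℝ) ^ k ≤ #B * Real.exp (k * (t * L + 2 + w * t)) := by
    have h1 : ((Fintype.card (Fin w → Bool) : ℕ) : ℝ) ^ (k * t) ≤ Real.exp (k * (w * t)) := by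
      have h2 : (2 : ℝ) ≤ Real.exp 1 := by linarith [Real.add_one_le_exp (1 : ℝ)]
      have h3 : (k : ℝ) * (w * t) = ((w * (k * t) : ℕ) : ℝ) := by push_cast; ring
      rw [h3, ← Real.exp_one_pow, Fintype.card_fun, Fintype.card_bool, Fintype.card_fin]
      push_cast
      rw [← pow_mul]
      gcongr
    have h2 := hexp ((Fintype.card Y : ℝ) ^ k) (Real.exp (k * (w * t)) * #B) (by positivity)
      (by positivity) (by
        rw [Fintype.card_fun, Fintype.card_fin] at hB
        push_cast at hB
        refine hB.trans ?_
        rw [mul_assoc]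
        gcongr)
    refine h2.trans_eq ?_
    rw [mul_add (k : ℝ) (t * L + 2), Real.exp_add]
    ring
  obtain ⟨i, hAi, hBi⟩ := exists_large_projections hk A B (a := t * L + 2)
    (b := t * L + 2 + w * t) (by positivity) (by positivity) hA' hB'
  set 𝒜 : Finset (Finset (Fin m)) := (A.image fun x => x i).image Subtype.val with h𝒜
  have h𝒜card : #𝒜 = #(A.image fun x => x i) :=
    Finset.card_image_of_injective _ Subtype.val_injective
  set H : Finset Z := {z | ∃ S ∈ 𝒜, ∀ j, z j ∈ S} with hH
  have hHcard : (3 / 4 : ℝ) ^ ℓ * Fintype.card Z ≤ #H := by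
    rw [hZ, ← mul_pow]
    have := le_card_covered_tuples ℓ 𝒜 (2 * (t * L + 2) + 1) (by
      rw [Fintype.card_fin, h𝒜card, Real.exp_add]
      have h2 : (2 : ℝ) ≤ Real.exp 1 := by linarith [Real.add_one_le_exp (1 : ℝ)]
      calc (2 : ℝ) ^ m ≤ 2 * Fintype.card X := hXcard
        _ ≤ Real.exp 1 * (#(A.image fun x => x i) * Real.exp (2 * (t * L + 2))) := by gcongr
        _ = _ := by ring) (by rwa [Fintype.card_fin])
    rwa [Fintype.card_fin] at this
  have hBH := card_le_of_avoiding H N _ hHcard (B.image fun y => y i) (by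
    intro y hy j hj
    obtain ⟨y, hyB, rfl⟩ := Finset.mem_image.1 hy
    obtain ⟨S, hS, hSj⟩ := (Finset.mem_filter.1 hj).2
    obtain ⟨S', hS', rfl⟩ := Finset.mem_image.1 hS
    obtain ⟨x, hxA, rfl⟩ := Finset.mem_image.1 hS'
    exact hAB x hxA y hyB i j hSj)
  rw [← hY] at hBH
  have hYpos : (0 : ℝ) < Fintype.card Y := by exact_mod_cast Fintype.card_pos
  have hfin : (Fintype.card Y : ℝ) * 1 ≤ Fintype.card Y *
      Real.exp (-((3 / 4 : ℝ) ^ ℓ * N) + 2 * (t * L + 2 + w * t)) := by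
    rw [mul_one, Real.exp_add]
    calc (Fintype.card Y : ℝ) ≤ _ := hBi
      _ ≤ Real.exp (-((3 / 4 : ℝ) ^ ℓ * N)) * Fintype.card Y *
          Real.exp (2 * (t * L + 2 + w * t)) := by gcongr
      _ = _ := by ring
  have := le_of_mul_le_mul_left hfin hYpos
  rw [Real.one_le_exp_iff] at this
  linarith

/-! ### Choice of parameters -/

/-- Logarithmic terms in `d`, in particular the tuple length `ℓ`, are eventually negligible
compared with `d`. -/
theorem exists_forall_log_le (K : ℝ) : ∃ d₀ : ℕ, ∀ d : ℕ, d₀ ≤ d →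
    144 * (2 + K * Real.logb 2 d) + 240 ≤ (d : ℝ) / 2 := by
  have h1 : (fun d : ℕ => 144 * (2 + K * Real.logb 2 d) + 240) =o[Filter.atTop]
      fun d : ℕ => (d : ℝ) := by
    have hid : Filter.Tendsto (fun d : ℕ => (d : ℝ)) Filter.atTop Filter.atTop :=
      tendsto_natCast_atTop_atTop
    have hlog : (fun d : ℕ => Real.log d) =o[Filter.atTop] fun d : ℕ => (d : ℝ) :=
      Real.isLittleO_log_id_atTop.comp_tendsto hid
    have hconst : (fun _ : ℕ => (528 : ℝ)) =o[Filter.atTop] fun d : ℕ => (d : ℝ) :=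
      (Asymptotics.isLittleO_const_id_atTop (528 : ℝ)).comp_tendsto hid
    refine ((hlog.const_mul_left (144 * K / Real.log 2)).add hconst).congr_left fun d => ?_
    rw [Real.logb]
    ring
  have h2 := h1.def (c := 1 / 2) (by norm_num)
  obtain ⟨d₀, hd₀⟩ := Filter.eventually_atTop.1 h2
  refine ⟨d₀, fun d hd => ?_⟩
  have h3 := hd₀ d hd
  rw [Real.norm_of_nonneg (Nat.cast_nonneg d)] at h3
  linarith [Real.le_norm_self (144 * (2 + K * Real.logb 2 (d : ℝ)) + 240)]

/-- The first half of the positions has room for the names of `n / 2` blocks. -/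
theorem le_two_pow_half {n d k : ℕ} (hn : 2 ≤ n) (hd : 2 * Real.logb 2 n ≤ d) (hk : k * 2 ≤ n) :
    k ≤ 2 ^ (d / 2) := by
  have hn0 : (0 : ℝ) < n := by positivity
  have h1 : (n : ℝ) ^ 2 ≤ 2 ^ d := by
    have : Real.logb 2 ((n : ℝ) ^ 2) ≤ d := by rw [Real.logb_pow]; exact_mod_cast hd
    rw [Real.logb_le_iff_le_rpow (by norm_num) (by positivity)] at this
    exact_mod_cast this
  have h2 : n ^ 2 ≤ 2 ^ d := by exact_mod_cast h1
  have h3 : (2 : ℕ) ^ d ≤ 2 ^ (2 * (d / 2) + 1) := Nat.pow_le_pow_right (by norm_num) (by omega)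
  have h4 : (k * 2) ^ 2 ≤ n ^ 2 := Nat.pow_le_pow_left hk 2
  have h5 : k ^ 2 ≤ (2 ^ (d / 2)) ^ 2 := by
    rw [← pow_mul, mul_comm (d / 2) 2]
    rw [pow_succ] at h3
    nlinarith
  exact (Nat.pow_le_pow_iff_left (by norm_num)).1 h5

theorem rpow_le_div_of_mul_rpow_le {n d s ε : ℝ} (hn : 0 < n) (hd : 0 < d)
    (h : n * d ^ (ε - 1) ≤ s) : d ^ ε ≤ s * d / n := by
  rw [le_div_iff₀ hn]
  calc d ^ ε * n = n * d ^ (ε - 1) * d := by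
        rw [Real.rpow_sub_one hd.ne']; field_simp
    _ ≤ s * d := by gcongr

/-- The logarithm `L` of the price of choosing a cell, for blocks of `w ^ 2 * d ^ 8` strings, is
proportional to `log (s d / n)`, because `w` is polynomial and `s d / n` is at least a power
of `d`. -/
theorem cell_entropy_le {C n d s w : ℕ} {ε : ℝ} (hε : 0 < ε) (hn : 0 < n) (hd : 2 ≤ d)
    (hw0 : 0 < w) (hs0 : 0 < s) (hw : w ≤ d ^ C) (hR : (d : ℝ) ^ ε ≤ (s : ℝ) * d / n) :
    1 + Real.log (2 * s * (w ^ 2 * d ^ 8) / n) ≤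
      (1 + (2 * C + 11) / ε) * Real.logb 2 ((s : ℝ) * d / n) := by
  have hn' : (0 : ℝ) < n := by exact_mod_cast hn
  have hd' : (2 : ℝ) ≤ d := by exact_mod_cast hd
  have hw' : (0 : ℝ) < w := by exact_mod_cast hw0
  have hs' : (0 : ℝ) < s := by exact_mod_cast hs0
  have hd0 : (0 : ℝ) < d := by linarith
  have hlog2 : Real.log 2 ≤ 1 := by linarith [Real.log_two_lt_d9]
  have hlog2' : 0.69 ≤ Real.log 2 := by linarith [Real.log_two_gt_d9]
  have hlogd : Real.log 2 ≤ Real.log d := Real.log_le_log (by norm_num) hd'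
  have hlogR : ε * Real.log d ≤ Real.log ((s : ℝ) * d / n) := by
    rw [← Real.log_rpow hd0]
    exact Real.log_le_log (by positivity) hR
  set r := Real.log ((s : ℝ) * d / n) with hr
  have hr0 : 0 ≤ r := le_trans (by positivity) hlogR
  have hrlogb : r ≤ Real.logb 2 ((s : ℝ) * d / n) := by
    rw [Real.logb, ← hr]
    exact le_div_self hr0 (by positivity) hlog2
  have hlogw : Real.log w ≤ C * Real.log d := by
    rw [← Real.log_pow]
    exact Real.log_le_log hw' (by exact_mod_cast hw)
  have h1 : Real.log (2 * s * (w ^ 2 * d ^ 8) / n) =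
      Real.log 2 + r + 2 * Real.log w + 7 * Real.log d := by
    rw [hr, Real.log_div (by positivity) hn'.ne', Real.log_div (by positivity) hn'.ne',
      Real.log_mul (by positivity) (by positivity), Real.log_mul (by positivity) (by positivity),
      Real.log_mul (by positivity) (by positivity), Real.log_mul (by positivity) (by positivity),
      Real.log_pow, Real.log_pow]
    push_cast
    ring
  have h2 : Real.log d ≤ r / ε := by rw [le_div_iff₀ hε]; linarith
  calc 1 + Real.log (2 * s * (w ^ 2 * d ^ 8) / n) ≤ r + (2 * C + 11) * Real.log d := by
        rw [h1]; linarith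
    _ ≤ r + (2 * C + 11) * (r / ε) := by gcongr
    _ = (1 + (2 * C + 11) / ε) * r := by ring
    _ ≤ _ := by gcongr

/-- If `ℓ` is about `log N` for a square `N`, then `(3/4) ^ ℓ * N` is at least of order `√N`. -/
theorem half_le_three_quarters_pow_mul {ℓ : ℕ} {q : ℝ} (hq : 0 < q) (hℓ : (2 : ℝ) ^ ℓ ≤ 4 * q ^ 2) :
    q / 2 ≤ (3 / 4 : ℝ) ^ ℓ * q ^ 2 := by
  have h1 : (1 / 2 : ℝ) ^ ℓ ≤ ((3 / 4 : ℝ) ^ ℓ) ^ 2 := by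
    rw [← pow_mul, mul_comm, pow_mul]
    gcongr
    norm_num
  have h2 : (1 / (2 * q)) ^ 2 ≤ ((3 / 4 : ℝ) ^ ℓ) ^ 2 := by
    refine le_trans ?_ h1
    rw [div_pow, one_pow, one_div_pow]
    refine one_div_le_one_div_of_le (by positivity) ?_
    linarith
  have h3 := (pow_le_pow_iff_left₀ (by positivity) (by positivity) (by norm_num)).1 h2
  calc q / 2 = 1 / (2 * q) * q ^ 2 := by field_simp
    _ ≤ _ := by gcongr

/-- The loss in the density of the databases stays below half of `√N = w d⁴`. -/
theorem two_mul_add_mul_lt {w d t b : ℝ} (hw : 1 ≤ w) (hd : 2 ≤ d) (ht : t ≤ d / 192)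
    (hb : 2 * b ≤ d) : 2 * (b + w * t) < w * d ^ 4 / 2 := by
  have h1 : w * t ≤ w * (d / 192) := by gcongr
  have h2 : d ≤ w * d := le_mul_of_one_le_left (by linarith) hw
  have h3 : 8 * (w * d) ≤ w * d ^ 4 := by
    calc 8 * (w * d) = 2 ^ 3 * (w * d) := by norm_num
      _ ≤ d ^ 3 * (w * d) := by gcongr
      _ = _ := by ring
  linarith

theorem mainTheorem4 (C : ℕ) (ε : ℝ) (hε : 0 < ε) :
    ∃ c : ℝ, 0 < c ∧
      ∀ n d s w t : ℕ, 2 ≤ n →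
        2 * Real.logb 2 (n : ℝ) ≤ (d : ℝ) →
        w ≤ d ^ C →
        w ^ 2 * d ^ 8 ≤ n →
        (n : ℝ) * (d : ℝ) ^ (ε - 1) ≤ (s : ℝ) →
        HasCertificates (partialMatch n d) s w t →
        c * ((d : ℝ) / Real.logb 2 ((s : ℝ) * (d : ℝ) / (n : ℝ))) ≤ (t : ℝ) := by
  obtain ⟨d₀, hd₀⟩ := exists_forall_log_le (2 * C + 8)
  set M : ℝ := 1 + (2 * C + 11) / ε with hM
  have hMpos : 0 < M := by positivity
  refine ⟨min (1 / (192 * M)) (ε / (d₀ + 1)), by positivity, ?_⟩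
  set c := min (1 / (192 * M)) (ε / (d₀ + 1)) with hc
  have hcpos : 0 < c := by positivity
  intro n d s w t hn hlogn hw hwn hs hcert
  have hn' : (0 : ℝ) < n := by positivity
  have hd : 2 ≤ d := by
    have h1 : (1 : ℝ) ≤ Real.logb 2 n := by
      rw [Real.le_logb_iff_rpow_le (by norm_num) hn']
      simpa using (show (2 : ℝ) ≤ n by exact_mod_cast hn)
    exact_mod_cast (show (2 : ℝ) ≤ d by linarith)
  have hd' : (2 : ℝ) ≤ d := by exact_mod_cast hd
  obtain ⟨hw0, ht0⟩ := hcert.pos_of_partialMatch (by omega) (by omega)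
  have hw1 : (1 : ℝ) ≤ w := by exact_mod_cast hw0
  have ht1 : (1 : ℝ) ≤ t := by exact_mod_cast ht0
  have hs0 : 0 < s := by
    have : (0 : ℝ) < s := lt_of_lt_of_le (by positivity) hs
    exact_mod_cast this
  have hR := rpow_le_div_of_mul_rpow_le hn' (by linarith) hs
  set ρ := Real.logb 2 ((s : ℝ) * d / n) with hρ
  have hρε : ε ≤ ρ := by
    have h1 : (2 : ℝ) ^ ε ≤ s * d / n := le_trans (by gcongr) hR
    rwa [hρ, Real.le_logb_iff_rpow_le (by norm_num) (lt_of_lt_of_le (by positivity) h1)]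
  have hρ0 : 0 < ρ := hε.trans_le hρε
  rw [← mul_div_assoc, div_le_iff₀ hρ0]
  -- For small `d` the bound is at most `1`, since `log (s d / n) ≥ ε`.
  rcases lt_or_ge d d₀ with hdd | hdd
  · have h1 : (d : ℝ) ≤ d₀ + 1 := by
      have : (d : ℝ) ≤ d₀ := by exact_mod_cast hdd.le
      linarith
    calc c * d ≤ ε / (d₀ + 1) * (d₀ + 1) := by
          gcongr
          exact min_le_right _ _
      _ = ε := by field_simp
      _ ≤ 1 * ρ := by linarith
      _ ≤ t * ρ := by gcongr
  by_contra! hlt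
  set N := w ^ 2 * d ^ 8 with hN
  have hdN : d ^ 8 ≤ N := Nat.le_mul_of_pos_left _ (by positivity)
  have hddN : d * d ≤ N := by
    have : d ^ 2 ≤ d ^ 8 := Nat.pow_le_pow_right (by omega) (by norm_num)
    rw [← sq]
    exact this.trans hdN
  have hN0 : 0 < N := by positivity
  have hN' : (0 : ℝ) < N := by exact_mod_cast hN0
  set k := n / N with hk
  have hk0 : 0 < k := Nat.div_pos hwn hN0
  have hkN : k * N ≤ n := Nat.div_mul_le_self n N
  have hnk : n ≤ 2 * (k * N) := by
    have h1 := Nat.lt_mul_div_succ n hN0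
    rw [← hk] at h1
    nlinarith
  have hnsd : (n : ℝ) ≤ s * d := by
    have h1 : (1 : ℝ) ≤ s * d / n := (Real.one_le_rpow (by linarith) hε.le).trans hR
    rwa [le_div_iff₀ hn', one_mul] at h1
  set L := 1 + Real.log (2 * s * (w ^ 2 * d ^ 8) / n) with hL
  have hNcast : (w : ℝ) ^ 2 * d ^ 8 = N := by rw [hN]; push_cast; rfl
  have hL1 : 1 ≤ L := by
    have : 0 ≤ Real.log (2 * s * (w ^ 2 * d ^ 8) / n) := by
      refine Real.log_nonneg ?_
      rw [le_div_iff₀ hn', hNcast]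
      have : (d : ℝ) ≤ N := by exact_mod_cast (Nat.le_mul_self d).trans hddN
      nlinarith [mul_le_mul_of_nonneg_left this (Nat.cast_nonneg (α := ℝ) s)]
    linarith
  have hLM : L ≤ M * ρ := cell_entropy_le hε (by omega) hd hw0 hs0 hw hR
  have htL : t * L ≤ d / 192 := by
    calc t * L ≤ t * (M * ρ) := by gcongr
      _ = M * (t * ρ) := by ring
      _ ≤ M * (c * d) := by gcongr
      _ ≤ M * (1 / (192 * M) * d) := by
        gcongr
        exact min_le_left _ _
      _ = d / 192 := by field_simp
  have htd' : (t : ℝ) ≤ d / 192 := le_trans (by nlinarith) htL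
  have htd : t ≤ d := by
    have : (t : ℝ) ≤ d := by linarith
    exact_mod_cast this
  have hkt : k * t ≤ s := by
    have h1 : n ≤ s * d := by exact_mod_cast hnsd
    have h2 : k * t * d ≤ s * d := by
      calc k * t * d ≤ k * d * d := by gcongr
        _ = k * (d * d) := by ring
        _ ≤ k * N := by gcongr
        _ ≤ s * d := hkN.trans h1
    exact Nat.le_of_mul_le_mul_right h2 (by omega)
  have hchoose : (s.choose (k * t) : ℝ) ≤ Real.exp (k * (t * L)) := by
    refine (choose_le_exp (Nat.mul_pos hk0 ht0) hs0).trans (Real.exp_le_exp.2 ?_)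
    push_cast
    rw [mul_assoc, hL]
    have hs' : (0 : ℝ) < s := by exact_mod_cast hs0
    refine mul_le_mul_of_nonneg_left (mul_le_mul_of_nonneg_left (add_le_add_right
      (Real.log_le_log (by positivity) ?_) _) (by positivity)) (by positivity)
    rw [hNcast, div_le_div_iff₀ (by positivity) hn']
    -- As `k` is at least `n / (2 N)`, the ratio `s / (k t)` is at most `2 s N / n`.
    have h1 : (n : ℝ) ≤ 2 * (k * N) := by exact_mod_cast hnk
    calc (s : ℝ) * n ≤ s * (2 * (k * N)) := by gcongr
      _ = s * (2 * (k * N)) * 1 := by ring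
      _ ≤ s * (2 * (k * N)) * t := by gcongr
      _ = _ := by ring
  set ℓ := Nat.clog 2 (2 * N) with hℓ
  have hℓ1 : 2 * N ≤ 2 ^ ℓ := Nat.le_pow_clog (by norm_num) _
  have hℓ2 : (2 : ℝ) ^ ℓ ≤ 4 * N := by
    have h1 : 0 < ℓ := Nat.clog_pos (by norm_num) (by omega)
    have h2 : 2 ^ (ℓ - 1) < 2 * N := Nat.pow_pred_clog_lt_self (by norm_num) (by omega)
    have h3 : 2 ^ ℓ = 2 ^ (ℓ - 1) * 2 := by rw [← pow_succ]; congr 1; omega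
    have : 2 ^ ℓ ≤ 4 * N := by omega
    exact_mod_cast this
  have hℓlog : (ℓ : ℝ) ≤ 2 + (2 * C + 8) * Real.logb 2 d := by
    have hd0 : (0 : ℝ) < d := by linarith
    have h1 : (2 : ℝ) ^ ℓ ≤ 4 * d ^ (2 * C + 8) := by
      refine hℓ2.trans ?_
      have : N ≤ d ^ (2 * C + 8) := by
        calc N ≤ (d ^ C) ^ 2 * d ^ 8 := by rw [hN]; gcongr
          _ = _ := by rw [← pow_mul, ← pow_add]; congr 1; ring
      gcongr
      exact_mod_cast this
    have h2 := Real.logb_le_logb_of_le (b := 2) (by norm_num) (by positivity) h1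
    rw [Real.logb_pow, Real.logb_self_eq_one (by norm_num),
      Real.logb_mul (by norm_num) (by positivity), Real.logb_pow] at h2
    have h3 : Real.logb 2 4 = 2 := by
      rw [show (4 : ℝ) = 2 ^ (2 : ℕ) by norm_num, Real.logb_pow,
        Real.logb_self_eq_one (by norm_num)]
      norm_num
    rw [h3] at h2
    push_cast at h2
    linarith
  have hgrow := hd₀ d hdd
  have hℓ0 : (0 : ℝ) ≤ ℓ := by positivity
  have hq : (N : ℝ) = ((w : ℝ) * (d : ℝ) ^ 4) ^ 2 := by rw [← hNcast]; ring
  have hlow := half_le_three_quarters_pow_mul (ℓ := ℓ) (q := (w : ℝ) * (d : ℝ) ^ 4)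
    (by positivity) (by rwa [← hq])
  rw [← hq] at hlow
  have hupp := two_mul_add_mul_lt (b := t * L + 2) hw1 hd' htd' (by linarith)
  -- The name of the block takes the first half of the positions.
  obtain ⟨p, m, rfl, hkp, hm⟩ : ∃ p m, d = p + m ∧ k ≤ 2 ^ p ∧ p ≤ m := by
    refine ⟨d / 2, d - d / 2, by omega, le_two_pow_half hn hlogn ?_, by omega⟩
    exact (Nat.mul_le_mul_left k (hd.trans ((Nat.le_mul_self d).trans hddN))).trans hkN
  have hm' : ((p + m : ℕ) : ℝ) ≤ 2 * m := by
    exact_mod_cast (by omega : p + m ≤ 2 * m)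
  have hbig : 24 * (2 * (t * L + 2) + 1 + 3 * ℓ) ≤ (m : ℝ) := by
    linarith
  have hbound := hcert.block_bound hk0 hN0 (by omega) hkN hkp hkt hℓ1 (by linarith) hchoose hbig
  linarith
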